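/- Let $\mathbb{K}$ be a field of characteristic zero, and let $m,n,r$ be integers with $m\geq 1$ and $2<r<n$. Let $E$ be the edge set of the complete bipartite graph $K_{m,n}$, and let $N=\#E=mn$. Let $M=M_{K_{m,n}}^{r}$ be the truncation to rank $r$ of the graphic matroid of $K_{m,n}$; that is, the matroid on $E$ whose bases are the $r$-element subsets of (edge sets of) spanning trees of $K_{m,n}$. Let $$\Phi=\sum_{B}\prod_{e\in B}x_e\in\mathbb{K}[x_e\mid e\in E]$$ be its basis generating function, where $B$ runs over the bases of $M$. Put $$\operatorname{Ann}(\Phi)=\Big\{P\in\mathbb{K}[x_e\mid e\in E]\;\Big|\;P\Big(\frac{\partial}{\partial x_e}\;\Big|\;e\in E\Big)\Phi=0\Big\},$$ let $A=\mathbb{K}[x_e\mid e\in E]/\operatorname{Ann}(\Phi)$, and let $A_k\subseteq A$ be the subspace of the classes of homogeneous polynomials of degree $k$, so that $A=\bigoplus_{k=0}^{r}A_k$. Let $L\in A_1$ be the class of $\sum_{e\in E}x_e$ (that is, $L=x_1+\cdots+x_N$ once $E$ is identified with $\{1,\dots,N\}$). Then multiplication by $L^{r-2}$ is a bijective map $$\times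 L^{r-2}\colon A_1\to A_{r-1}.$$ -/

import Mathlib

namespace TruncMatroid

section Graphic

variable {V : Type*}

/-- The spanning subgraph of `G` whose edges are exactly those in `I`. -/
def edgeSubgraph (G : SimpleGraph V) (I : Set G.edgeSet) : SimpleGraph V :=
  SimpleGraph.fromEdgeSet (Subtype.val '' I)

theorem edgeSubgraph_mono (G : SimpleGraph V) {I J : Set G.edgeSet} (h : I ⊆ J) :
    edgeSubgraph G I ≤ edgeSubgraph G J :=
  SimpleGraph.fromEdgeSet_mono (Set.image_mono h)

theorem edgeSubgraph_le (G : SimpleGraph V) (I : Set G.edgeSet) : edgeSubgraph G I ≤ G := by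
  intro a b h
  rw [edgeSubgraph, SimpleGraph.fromEdgeSet_adj] at h
  obtain ⟨⟨e, -, he⟩, -⟩ := h
  have := e.2
  rwa [he] at this

theorem edgeSubgraph_adj (G : SimpleGraph V) (I : Set G.edgeSet) (e : G.edgeSet) {a b : V}
    (he : e.1 = s(a, b)) : (edgeSubgraph G I).Adj a b ↔ e ∈ I := by
  have hab : G.Adj a b := by have := e.2; rwa [he] at this
  rw [edgeSubgraph, SimpleGraph.fromEdgeSet_adj, ← he]
  simp [hab.ne]

theorem edgeSubgraph_of_le (G : SimpleGraph V) {H : SimpleGraph V} (h : H ≤ G) :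
    edgeSubgraph G {e | e.1 ∈ H.edgeSet} = H := by
  ext a b
  refine ⟨fun hab => ?_, fun hab => ?_⟩
  · have hG := edgeSubgraph_le _ _ hab
    exact (edgeSubgraph_adj G _ ⟨s(a, b), hG⟩ rfl).1 hab
  · exact (edgeSubgraph_adj G _ ⟨s(a, b), h hab⟩ rfl).2 hab

theorem edgeSubgraph_le_iff (G : SimpleGraph V) {I J : Set G.edgeSet} :
    edgeSubgraph G I ≤ edgeSubgraph G J ↔ I ⊆ J := by
  refine ⟨fun h e he => ?_, edgeSubgraph_mono G⟩
  obtain ⟨e, hG⟩ := e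
  induction e with
  | h a b =>
    exact (edgeSubgraph_adj G J ⟨s(a, b), hG⟩ rfl).1
      (h ((edgeSubgraph_adj G I ⟨s(a, b), hG⟩ rfl).2 he))

theorem maximal_isAcyclic_edgeSubgraph_iff (G : SimpleGraph V) (I : Set G.edgeSet) :
    Maximal (fun I => (edgeSubgraph G I).IsAcyclic) I ↔
      Maximal (fun H => H ≤ G ∧ H.IsAcyclic) (edgeSubgraph G I) := by
  refine ⟨fun h => ⟨⟨edgeSubgraph_le G I, h.prop⟩, fun H hH hle => ?_⟩,
    fun h => ⟨h.prop.2, fun J hJ hle => ?_⟩⟩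
  · rw [← edgeSubgraph_of_le G hH.1] at hle ⊢
    refine edgeSubgraph_mono G (h.le_of_ge ?_ ((edgeSubgraph_le_iff G).1 hle))
    simpa only [edgeSubgraph_of_le G hH.1] using hH.2
  · exact (edgeSubgraph_le_iff G).1
      (h.le_of_ge ⟨edgeSubgraph_le G J, hJ⟩ (edgeSubgraph_mono G hle))

/-- The graphic matroid of a finite graph `G`: the ground set is the set of edges of `G`, and a
set of edges is independent if it contains no cycle. -/
def graphicMatroid [Finite V] (G : SimpleGraph V) : Matroid G.edgeSet :=
  (IndepMatroid.ofBdd (E := Set.univ)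
    (Indep := fun I => (edgeSubgraph G I).IsAcyclic)
    (indep_empty := by simp [edgeSubgraph])
    (indep_subset := fun _ _ hJ hIJ => hJ.anti (edgeSubgraph_mono G hIJ))
    (indep_aug := by
      intro I B hI hImax hB
      rw [maximal_isAcyclic_edgeSubgraph_iff,
        SimpleGraph.maximal_isAcyclic_iff_reachable_eq (edgeSubgraph_le G I) hI] at hImax
      have hBr := SimpleGraph.reachable_eq_of_maximal_isAcyclic _
        ((maximal_isAcyclic_edgeSubgraph_iff G B).1 hB)
      have : ∃ u v, G.Reachable u v ∧ ¬ (edgeSubgraph G I).Reachable u v := by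
        by_contra! hcon
        apply hImax
        ext u v
        exact ⟨fun h => h.mono (edgeSubgraph_le G I), hcon u v⟩
      obtain ⟨u, v, huv, hnuv⟩ := this
      rw [← hBr] at huv
      obtain ⟨p⟩ := huv
      obtain ⟨d, -, hd1, hd2⟩ := p.exists_boundary_dart
        {w | (edgeSubgraph G I).Reachable u w} (SimpleGraph.Reachable.refl u) hnuv
      have hnr : ¬ (edgeSubgraph G I).Reachable d.fst d.snd := fun h => hd2 (hd1.trans h)
      have hG := edgeSubgraph_le G B d.adj
      refine ⟨⟨s(d.fst, d.snd), hG⟩, ⟨?_, fun hmem => ?_⟩, ?_⟩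
      · exact (edgeSubgraph_adj G B _ rfl).1 d.adj
      · exact hnr ((edgeSubgraph_adj G I _ rfl).2 hmem).reachable
      · refine (hI.sup_edge_of_not_reachable hnr).anti ?_
        rw [edgeSubgraph, Set.image_insert_eq, Set.insert_eq, Set.union_comm,
          SimpleGraph.fromEdgeSet_union]
        exact le_rfl)
    (subset_ground := fun I _ => Set.subset_univ I)
    (indep_bdd := ⟨(Set.univ : Set G.edgeSet).ncard, fun I _ => by
      rw [(Set.toFinite _).cast_ncard_eq]
      exact Set.encard_le_encard (Set.subset_univ I)⟩)).matroid

@[simp] theorem graphicMatroid_ground [Finite V] (G : SimpleGraph V) :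
    (graphicMatroid G).E = Set.univ := rfl

theorem graphicMatroid_indep_iff [Finite V] (G : SimpleGraph V) (I : Set G.edgeSet) :
    (graphicMatroid G).Indep I ↔ (edgeSubgraph G I).IsAcyclic :=
  Iff.rfl

/-- For a connected graph, the bases of the graphic matroid are the spanning trees. -/
theorem graphicMatroid_isBase_iff [Finite V] (G : SimpleGraph V) (hG : G.Connected)
    (B : Set G.edgeSet) : (graphicMatroid G).IsBase B ↔ (edgeSubgraph G B).IsTree := by
  rw [← hG.maximal_le_isAcyclic_iff_isTree (edgeSubgraph_le G B),
    ← maximal_isAcyclic_edgeSubgraph_iff, Matroid.isBase_iff_maximal_indep]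
  exact Iff.rfl

end Graphic

section Truncation

variable {α : Type*}

/-- The truncation of a matroid `M` to rank `r`: the independent sets are the independent sets of
`M` with at most `r` elements. See `truncation_isBase_iff` for its bases. -/
def truncation (M : Matroid α) (r : ℕ) : Matroid α :=
  (IndepMatroid.ofBddAugment (E := M.E)
    (Indep := fun I => M.Indep I ∧ I.encard ≤ r)
    (indep_empty := by simp)
    (indep_subset := fun _ _ hJ hIJ => ⟨hJ.1.subset hIJ, (Set.encard_le_encard hIJ).trans hJ.2⟩)
    (indep_aug := by
      intro I J hI hJ hlt
      obtain ⟨e, he, hins⟩ := hI.1.augment hJ.1 hlt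
      refine ⟨e, he.1, he.2, hins, ?_⟩
      rw [Set.encard_insert_of_notMem he.2]
      exact (Order.add_one_le_of_lt hlt).trans hJ.2)
    (indep_bdd := ⟨r, fun _ h => h.2⟩)
    (subset_ground := fun _ h => h.1.subset_ground)).matroid

@[simp] theorem truncation_ground (M : Matroid α) (r : ℕ) : (truncation M r).E = M.E := rfl

theorem truncation_indep_iff (M : Matroid α) (r : ℕ) (I : Set α) :
    (truncation M r).Indep I ↔ M.Indep I ∧ I.encard ≤ r :=
  Iff.rfl

/-- If `r` is at most the rank of `M`, the bases of the truncation are the `r`-element subsets of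
bases of `M`. -/
theorem truncation_isBase_iff (M : Matroid α) (r : ℕ) (hr : (r : ℕ∞) ≤ M.eRank) (B : Set α) :
    (truncation M r).IsBase B ↔ B.encard = r ∧ ∃ B', M.IsBase B' ∧ B ⊆ B' := by
  have key : (truncation M r).IsBase B ↔ M.Indep B ∧ B.encard = r := by
    rw [Matroid.isBase_iff_maximal_indep]
    refine ⟨fun h => ?_, fun h => ⟨(truncation_indep_iff M r B).2 ⟨h.1, h.2.le⟩, ?_⟩⟩
    · have hB := (truncation_indep_iff M r B).1 h.prop
      refine ⟨hB.1, hB.2.antisymm (le_of_not_gt fun hlt => ?_)⟩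
      obtain ⟨C, hC⟩ := M.exists_isBase
      obtain ⟨e, he, hins⟩ := hB.1.augment hC.indep
        (hlt.trans_le (hr.trans hC.encard_eq_eRank.ge))
      refine he.2 (h.le_of_ge ((truncation_indep_iff M r _).2 ⟨hins, ?_⟩)
        (Set.subset_insert e B) (Set.mem_insert e B))
      rw [Set.encard_insert_of_notMem he.2]
      exact Order.add_one_le_of_lt hlt
    · intro C hC hBC
      have hC' := (truncation_indep_iff M r C).1 hC
      have hfin : C.Finite := Set.finite_of_encard_le_coe hC'.2
      exact (hfin.eq_of_subset_of_encard_le' hBC (hC'.2.trans h.2.ge)).ge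
  rw [key, Matroid.indep_iff, and_comm]

end Truncation

section Algebra

open MvPolynomial
open scoped IsMulCommutative

variable (K : Type*) [Field K] {σ : Type*}

theorem pderiv_pderiv_comm (i j : σ) (F : MvPolynomial σ K) :
    pderiv i (pderiv j F) = pderiv j (pderiv i F) := by
  classical
  have h : ⁅(pderiv i : Derivation K (MvPolynomial σ K) (MvPolynomial σ K)),
      (pderiv j : Derivation K (MvPolynomial σ K) (MvPolynomial σ K))⁆ = 0 := by
    refine MvPolynomial.derivation_ext ?_
    intro k
    simp [Derivation.commutator_apply, pderiv_X, Pi.single_apply, apply_ite]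
  have h2 := DFunLike.congr_fun h F
  rw [Derivation.commutator_apply] at h2
  exact sub_eq_zero.1 h2

/-- The `K`-algebra of differential operators generated by the `∂/∂x_i`. -/
noncomputable def diffOps (σ : Type*) : Subalgebra K (Module.End K (MvPolynomial σ K)) :=
  Algebra.adjoin K (Set.range fun i : σ => (pderiv (R := K) i).toLinearMap)

instance diffOps_isMulCommutative (σ : Type*) : IsMulCommutative (diffOps K σ) :=
  Algebra.isMulCommutative_adjoin K (by
    rintro _ ⟨i, rfl⟩ _ ⟨j, rfl⟩
    exact LinearMap.ext fun F => pderiv_pderiv_comm K i j F)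

/-- The algebra homomorphism sending a polynomial `P` to the differential operator
`P(∂/∂x_1, …, ∂/∂x_N)`. -/
noncomputable def diffOp (σ : Type*) :
    MvPolynomial σ K →ₐ[K] Module.End K (MvPolynomial σ K) :=
  (diffOps K σ).val.comp
    (MvPolynomial.aeval fun i : σ =>
      (⟨(pderiv (R := K) i).toLinearMap, Algebra.subset_adjoin ⟨i, rfl⟩⟩ : diffOps K σ))

theorem diffOp_X (i : σ) (F : MvPolynomial σ K) : diffOp K σ (X i) F = pderiv i F := by
  simp [diffOp]

theorem diffOp_C (c : K) (F : MvPolynomial σ K) : diffOp K σ (C c) F = c • F := by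
  rw [← MvPolynomial.algebraMap_eq, AlgHom.commutes, Module.algebraMap_end_apply]

variable {K}

/-- `Ann(Φ)`, the ideal of all polynomials `P` with `P(∂/∂x_1, …, ∂/∂x_N) Φ = 0`. -/
def annIdeal (Φ : MvPolynomial σ K) : Ideal (MvPolynomial σ K) where
  carrier := {P | diffOp K σ P Φ = 0}
  zero_mem' := by simp
  add_mem' := by
    intro P Q hP hQ
    simp only [Set.mem_ofPred_eq] at hP hQ ⊢
    rw [map_add, LinearMap.add_apply, hP, hQ, add_zero]
  smul_mem' := by
    intro P Q hQ
    simp only [Set.mem_ofPred_eq] at hQ ⊢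
    rw [smul_eq_mul, map_mul, Module.End.mul_apply, hQ, map_zero]

/-- The degree `k` component `A_k` of `A = K[x_1, …, x_N] / Ann(Φ)`: the classes of the homogeneous
polynomials of degree `k`. -/
noncomputable def gradedPiece (Φ : MvPolynomial σ K) (k : ℕ) :
    Submodule K (MvPolynomial σ K ⧸ annIdeal Φ) :=
  (homogeneousSubmodule σ K k).map (Ideal.Quotient.mkₐ K (annIdeal Φ)).toLinearMap

/-- The class of `x_1 + ⋯ + x_N` in `K[x_1, …, x_N] / Ann(Φ)`. -/
noncomputable def sumVars [Finite σ] (Φ : MvPolynomial σ K) : MvPolynomial σ K ⧸ annIdeal Φ :=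
  letI := Fintype.ofFinite σ
  Ideal.Quotient.mk (annIdeal Φ) (∑ i, X i)

variable (K)

open scoped Classical in
/-- The basis generating function `Φ_M = ∑_{B} ∏_{b ∈ B} x_b` of a matroid `M` on a finite type,
the sum being over the bases `B` of `M`. -/
noncomputable def basisGenFun [Finite σ] (M : Matroid σ) : MvPolynomial σ K :=
  letI := Fintype.ofFinite σ
  ∑ B : Finset σ with M.IsBase (B : Set σ), ∏ b ∈ B, X b

end Algebra

end TruncMatroid

/-! ### Symmetric real matrices with one positive direction. -/

section LinearAlgebra

open Matrix

variable {ι : Type*} [Fintype ι]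

/-! Write H_S for the Hessian at the all-one vector of the generating function of the link of S, and
Q_S for its quadratic form. The operator of L^(r-2) · ∑ c_i x_i sends Φ to (r-2)! · ∑ (H_∅ c)_f x_f,
and every P of degree r-1 sends Φ to a linear form, so the theorem follows from det H_∅ ≠ 0
(`bijOn_sumVars_pow_mul`). This determinant is an integer, so it suffices to show that H_∅ has
trivial kernel over ℝ.

Over ℝ every Q_S with |S| ≤ r-2 has at most one positive direction, in the form of a reverse
Cauchy-Schwarz inequality (`Augmentable.reverseCauchySchwarz`). When |S| = r-2, augmentation makes
H_S the adjacency matrix of a complete multipartite graph on the nonloops; smaller S are reached by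
the trickle-down principle, since the Q_{S∪g} sum to a multiple of Q_S and the row sums of H_{S∪g}
are a multiple of row g of H_S.

The same identities push the kernel down to the links. If H_S v = 0, then 1 · H_{S∪g} v = 0, so
Q_{S∪g}(v) ≤ 0 for each g; these numbers sum to a multiple of Q_S(v) = 0, so all vanish, and the
equality case gives H_{S∪g} v = 0. Finally, for an edge ij let S consist of r-2 other edges at i: no
other edge is parallel to ij after contracting S, and in rank two this forces v to vanish at ij. -/

theorem Matrix.IsSymm.dotProduct_mulVec_comm {R : Type*} [CommRing R] {H : Matrix ι ι R}
    (hH : H.IsSymm) (v w : ι → R) : v ⬝ᵥ H *ᵥ w = w ⬝ᵥ H *ᵥ v := by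
  rw [dotProduct_mulVec, ← mulVec_transpose, hH.eq, dotProduct_comm]

/-- The Fredholm alternative for symmetric matrices. -/
theorem Matrix.IsSymm.exists_mulVec_eq {R : Type*} [Field R] {H : Matrix ι ι R}
    (hH : H.IsSymm) (b : ι → R) (hb : ∀ z, H *ᵥ z = 0 → z ⬝ᵥ b = 0) : ∃ y, H *ᵥ y = b := by
  classical
  by_contra hcon
  have hmem : b ∉ LinearMap.range H.mulVecLin := fun ⟨y, hy⟩ => hcon ⟨y, hy⟩
  -- A functional that kills the range but not `b` is pairing with some vector; by symmetry of `H`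
  -- that vector lies in the kernel, so it also kills `b`.
  obtain ⟨f, hfb, hf⟩ := Submodule.exists_le_ker_of_notMem hmem
  have hfz : ∀ x, f x = (fun i => f (Pi.single i 1)) ⬝ᵥ x := by
    intro x
    conv_lhs => rw [pi_eq_sum_univ' x]
    simp only [map_sum, map_smul, dotProduct, smul_eq_mul, mul_comm]
  refine hfb ((hfz b).trans (hb _ (dotProduct_eq_zero _ fun w => ?_)))
  rw [dotProduct_comm, hH.dotProduct_mulVec_comm, ← hfz]
  exact LinearMap.mem_ker.1 (hf ⟨w, rfl⟩)

/-- The reverse Cauchy-Schwarz inequality of the form of `H` with respect to the all-one vector. -/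
def ReverseCauchySchwarz (H : Matrix ι ι ℝ) : Prop :=
  ∀ v, (v ⬝ᵥ H *ᵥ v) * (1 ⬝ᵥ H *ᵥ 1) ≤ (1 ⬝ᵥ H *ᵥ v) ^ 2

theorem quadForm_add_smul {H : Matrix ι ι ℝ} (hH : H.IsSymm) (v w : ι → ℝ) (t : ℝ) :
    (v + t • w) ⬝ᵥ H *ᵥ (v + t • w) =
      v ⬝ᵥ H *ᵥ v + 2 * t * (v ⬝ᵥ H *ᵥ w) + t ^ 2 * (w ⬝ᵥ H *ᵥ w) := by
  simp only [mulVec_add, mulVec_smul, add_dotProduct, dotProduct_add, smul_dotProduct,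
    dotProduct_smul, smul_eq_mul, hH.dotProduct_mulVec_comm w v]
  ring

/-- Project `v` along the all-one vector onto its `H`-orthogonal complement, where the form is
nonpositive. -/
theorem reverseCauchySchwarz_of_nonpos {H : Matrix ι ι ℝ} (hH : H.IsSymm)
    (hT : 0 < 1 ⬝ᵥ H *ᵥ (1 : ι → ℝ))
    (h : ∀ x, 1 ⬝ᵥ H *ᵥ x = 0 → x ⬝ᵥ H *ᵥ x ≤ 0) : ReverseCauchySchwarz H := by
  intro v
  set T := 1 ⬝ᵥ H *ᵥ (1 : ι → ℝ) with hTdef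
  set l := 1 ⬝ᵥ H *ᵥ v with hl
  have h1 := h (v + (-(l / T)) • 1) (by
    rw [mulVec_add, mulVec_smul, dotProduct_add, dotProduct_smul, ← hTdef, ← hl, smul_eq_mul]
    field_simp
    ring)
  rw [quadForm_add_smul hH, hH.dotProduct_mulVec_comm v 1, ← hTdef, ← hl] at h1
  have h2 := mul_le_mul_of_nonneg_right h1 hT.le
  field_simp at h2
  nlinarith

/-- Move `v` along the all-one vector into the hyperplane `l = 0`, where the form is nonpositive;
completing the square in the displacement `t` gives the inequality. -/
theorem reverseCauchySchwarz_of_le_sq {H : Matrix ι ι ℝ} (hH : H.IsSymm)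
    (hT : 0 < 1 ⬝ᵥ H *ᵥ (1 : ι → ℝ)) (l : ι → ℝ)
    (h : ∀ v, v ⬝ᵥ H *ᵥ v ≤ (l ⬝ᵥ v) ^ 2) : ReverseCauchySchwarz H := by
  intro v
  have hl : l ⬝ᵥ 1 ≠ 0 := by
    intro h0
    have := h 1
    rw [h0] at this
    linarith [this]
  have h1 := h (v + (-((l ⬝ᵥ v) / (l ⬝ᵥ 1))) • 1)
  rw [quadForm_add_smul hH, hH.dotProduct_mulVec_comm v 1, dotProduct_add, dotProduct_smul,
    smul_eq_mul, neg_mul, div_mul_cancel₀ _ hl, add_neg_cancel] at h1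
  set t := -((l ⬝ᵥ v) / (l ⬝ᵥ 1))
  set T := 1 ⬝ᵥ H *ᵥ (1 : ι → ℝ)
  nlinarith [sq_nonneg (1 ⬝ᵥ H *ᵥ v + t * T)]

/-- Equality case: the inequality at `v + t • w` is a quadratic in `t` that is nonnegative and has
no constant term, so its linear coefficient vanishes for every `w`. -/
theorem ReverseCauchySchwarz.mulVec_eq_zero {H : Matrix ι ι ℝ} (h : ReverseCauchySchwarz H)
    (hH : H.IsSymm) (hT : 0 < 1 ⬝ᵥ H *ᵥ (1 : ι → ℝ)) {v : ι → ℝ}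
    (hv : 1 ⬝ᵥ H *ᵥ v = 0) (hQ : v ⬝ᵥ H *ᵥ v = 0) : H *ᵥ v = 0 := by
  refine dotProduct_eq_zero _ fun w => ?_
  rw [dotProduct_comm, hH.dotProduct_mulVec_comm]
  have key : ∀ t : ℝ, 0 ≤ ((1 ⬝ᵥ H *ᵥ w) ^ 2 -
      (w ⬝ᵥ H *ᵥ w) * (1 ⬝ᵥ H *ᵥ (1 : ι → ℝ))) * (t * t) +
      (-2 * (v ⬝ᵥ H *ᵥ w) * (1 ⬝ᵥ H *ᵥ (1 : ι → ℝ))) * t + 0 := by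
    intro t
    have := h (v + t • w)
    rw [quadForm_add_smul hH, mulVec_add, mulVec_smul, dotProduct_add, dotProduct_smul, hv, hQ,
      smul_eq_mul] at this
    linarith
  have := discrim_le_zero key
  rw [discrim] at this
  have h2 : (-2 * (v ⬝ᵥ H *ᵥ w) * (1 ⬝ᵥ H *ᵥ (1 : ι → ℝ))) = 0 := by
    refine pow_eq_zero_iff (two_ne_zero) |>.1 (le_antisymm (by linarith) (sq_nonneg _))
  simpa [hT.ne'] using h2

/-- The quadratic form of the Laplacian of a weighted graph. -/
theorem sum_rowSum_mul_sq_sub_quadForm {H : Matrix ι ι ℝ} (hH : H.IsSymm) (v : ι → ℝ) :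
    2 * (∑ e, (H *ᵥ 1) e * v e ^ 2 - v ⬝ᵥ H *ᵥ v) = ∑ e, ∑ f, H e f * (v e - v f) ^ 2 := by
  have h1 : ∑ e, (H *ᵥ 1) e * v e ^ 2 = ∑ e, ∑ f, H e f * v e ^ 2 := by
    simp [mulVec, dotProduct, Finset.sum_mul]
  have h2 : ∑ e, (H *ᵥ 1) e * v e ^ 2 = ∑ e, ∑ f, H e f * v f ^ 2 := by
    rw [h1, Finset.sum_comm]
    exact Finset.sum_congr rfl fun e _ => Finset.sum_congr rfl fun f _ => by rw [hH.apply]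
  have h3 : v ⬝ᵥ H *ᵥ v = ∑ e, ∑ f, H e f * (v e * v f) := by
    simp only [mulVec, dotProduct, Finset.mul_sum]
    exact Finset.sum_congr rfl fun e _ => Finset.sum_congr rfl fun f _ => by ring
  have : 2 * (∑ e, (H *ᵥ 1) e * v e ^ 2 - v ⬝ᵥ H *ᵥ v) =
      ∑ e, (H *ᵥ 1) e * v e ^ 2 + ∑ e, (H *ᵥ 1) e * v e ^ 2 - 2 * (v ⬝ᵥ H *ᵥ v) := by ring
  rw [this]
  nth_rw 1 [h1]
  rw [h2, h3, Finset.mul_sum, ← Finset.sum_add_distrib, ← Finset.sum_sub_distrib]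
  refine Finset.sum_congr rfl fun e _ => ?_
  rw [Finset.mul_sum, ← Finset.sum_add_distrib, ← Finset.sum_sub_distrib]
  exact Finset.sum_congr rfl fun f _ => by ring

/-- The trickle-down principle: if every eigenvalue of the random walk on a connected weighted
graph satisfies `t ≤ t ^ 2`, then only one of them is positive. -/
theorem reverseCauchySchwarz_of_trickle {H : Matrix ι ι ℝ} (hH : H.IsSymm)
    (hnn : ∀ e f, 0 ≤ H e f) (hT : 0 < 1 ⬝ᵥ H *ᵥ (1 : ι → ℝ))
    (hconn : ∀ z : ι → ℝ, (∀ e f, H e f ≠ 0 → z e = z f) →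
      ∃ c, ∀ e, (H *ᵥ 1) e ≠ 0 → z e = c)
    (h : ∀ y, y ⬝ᵥ H *ᵥ y ≤ ∑ g, (H *ᵥ y) g ^ 2 / (H *ᵥ 1) g) : ReverseCauchySchwarz H := by
  classical
  refine reverseCauchySchwarz_of_nonpos hH hT fun x hx => ?_
  set d := H *ᵥ (1 : ι → ℝ) with hd
  have hzero : ∀ e, d e = 0 → ∀ f, H e f = 0 := by
    intro e he f
    have : ∑ f, H e f = 0 := by simpa [hd, mulVec, dotProduct] using he
    exact (Finset.sum_eq_zero_iff_of_nonneg fun f _ => hnn e f).1 this f (Finset.mem_univ f)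
  have hdzero : ∀ e, d e = 0 → ∀ y, (H *ᵥ y) e = 0 := by
    intro e he y
    simp [mulVec, dotProduct, hzero e he]
  have hdd : ∀ y, 1 ⬝ᵥ H *ᵥ y = d ⬝ᵥ y := fun y => by
    rw [hH.dotProduct_mulVec_comm, dotProduct_comm]
  rw [hdd] at hx
  have hLap : ∀ y, 0 ≤ ∑ e, d e * y e ^ 2 - y ⬝ᵥ H *ᵥ y := by
    intro y
    have := sum_rowSum_mul_sq_sub_quadForm hH y
    have h0 : 0 ≤ ∑ e, ∑ f, H e f * (y e - y f) ^ 2 :=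
      Finset.sum_nonneg fun e _ => Finset.sum_nonneg fun f _ => mul_nonneg (hnn e f) (sq_nonneg _)
    linarith
  -- With W = D⁻¹H the random walk, this solves (1 - W) y = x without diagonalising W. By
  -- connectivity a kernel vector of the Laplacian D - H is constant where `d ≠ 0`, hence orthogonal
  -- to D x.
  obtain ⟨y, hy⟩ := Matrix.IsSymm.exists_mulVec_eq (H := diagonal d - H)
    ((isSymm_diagonal d).sub hH) (fun e => d e * x e) (by
      intro z hz
      have hz2 : z ⬝ᵥ (diagonal d - H) *ᵥ z = 0 := by rw [hz, dotProduct_zero]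
      have hz3 : ∑ e, d e * z e ^ 2 - z ⬝ᵥ H *ᵥ z = 0 := by
        rw [← hz2, sub_mulVec, dotProduct_sub]
        congr 1
        simp only [dotProduct, mulVec_diagonal]
        exact Finset.sum_congr rfl fun e _ => by ring
      have hz4 := sum_rowSum_mul_sq_sub_quadForm hH z
      rw [hz3, mul_zero] at hz4
      obtain ⟨c, hc⟩ := hconn z (by
        intro e f hef
        have h1 := (Finset.sum_eq_zero_iff_of_nonneg fun e _ => Finset.sum_nonneg fun f _ =>
          mul_nonneg (hnn e f) (sq_nonneg (z e - z f))).1 hz4.symm e (Finset.mem_univ e)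
        have h2 := (Finset.sum_eq_zero_iff_of_nonneg fun f _ =>
          mul_nonneg (hnn e f) (sq_nonneg (z e - z f))).1 h1 f (Finset.mem_univ f)
        have h3 := (mul_eq_zero.1 h2).resolve_left hef
        exact sub_eq_zero.1 (pow_eq_zero_iff two_ne_zero |>.1 h3))
      calc z ⬝ᵥ (fun e => d e * x e) = c * (d ⬝ᵥ x) := by
            simp only [dotProduct, Finset.mul_sum]
            refine Finset.sum_congr rfl fun e _ => ?_
            by_cases he : d e = 0
            · simp [he]
            · rw [hc e he]
        _ = 0 := by rw [hx, mul_zero])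
  -- `a` is W y. Where `d g = 0` the whole row of `H` vanishes, so the default value of the division
  -- is harmless.
  set a : ι → ℝ := fun g => (H *ᵥ y) g / d g with ha
  have hda : ∀ e, d e * a e = (H *ᵥ y) e := by
    intro e
    by_cases he : d e = 0
    · rw [hdzero e he, he, zero_mul]
    · rw [ha]; field_simp
  have hxy : ∀ e, d e ≠ 0 → x e = y e - a e := by
    intro e he
    have h1 := congrFun hy e
    rw [sub_mulVec, Pi.sub_apply, mulVec_diagonal, ← hda e] at h1
    have : d e * (y e - a e - x e) = 0 := by linarith
    linarith [(mul_eq_zero.1 this).resolve_left he]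
  have hHx : H *ᵥ x = H *ᵥ (y + (-1 : ℝ) • a) := by
    ext e
    simp only [mulVec, dotProduct]
    refine Finset.sum_congr rfl fun f _ => ?_
    by_cases hf : d f = 0
    · rw [← hH.apply, hzero f hf, zero_mul, zero_mul]
    · rw [hxy f hf]; simp [sub_eq_add_neg]
  have hQx : x ⬝ᵥ H *ᵥ x = (y + (-1 : ℝ) • a) ⬝ᵥ H *ᵥ (y + (-1 : ℝ) • a) := by
    rw [hHx, hH.dotProduct_mulVec_comm, hHx]
  -- Q(x) = Q(y) - 2 ∑ d a² + Q(a), and both Q(y) and Q(a) are at most ∑ d a²: the first by `h`, the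
  -- second by positivity of the Laplacian.
  rw [hQx, quadForm_add_smul hH, hH.dotProduct_mulVec_comm y a]
  have h1 : a ⬝ᵥ H *ᵥ y = ∑ e, d e * a e ^ 2 := by
    simp only [dotProduct, ← hda]
    exact Finset.sum_congr rfl fun e _ => by ring
  have h2 : ∑ g, (H *ᵥ y) g ^ 2 / d g = ∑ e, d e * a e ^ 2 := by
    refine Finset.sum_congr rfl fun e _ => ?_
    rw [← hda]
    by_cases he : d e = 0
    · simp [he]
    · field_simp
  have h3 := h y
  have h4 := hLap a
  rw [h2] at h3
  rw [h1]
  linarith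

/-- The form attached to an equivalence relation is positive semidefinite. -/
theorem sum_equivalence_mul_nonneg {α : Type*} (s : Finset α) (R : α → α → Prop)
    [DecidableRel R] (hR : Equivalence R) (v : α → ℝ) :
    0 ≤ ∑ e ∈ s, ∑ f ∈ s, if R e f then v e * v f else 0 := by
  classical
  let c : α → Finset α := fun e => s.filter (R e)
  have hc : ∀ e ∈ s, ∀ f ∈ s, (R e f ↔ c e = c f) := by
    intro e he f hf
    refine ⟨fun h => Finset.filter_congr fun g _ => ⟨fun h2 => hR.trans (hR.symm h) h2,
      fun h2 => hR.trans h h2⟩, fun h => ?_⟩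
    have : f ∈ c f := Finset.mem_filter.2 ⟨hf, hR.refl f⟩
    rw [← h] at this
    exact (Finset.mem_filter.1 this).2
  have : ∑ e ∈ s, ∑ f ∈ s, (if R e f then v e * v f else 0) =
      ∑ C ∈ s.image c, (∑ e ∈ s with c e = C, v e) ^ 2 := by
    have h1 : ∀ C ∈ s.image c, (∑ e ∈ s with c e = C, v e) ^ 2 =
        ∑ e ∈ s with c e = C, ∑ f ∈ s, (if R e f then v e * v f else 0) := by
      intro C _
      rw [sq, Finset.sum_mul]
      refine Finset.sum_congr rfl fun e he => ?_
      rw [Finset.mem_filter] at he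
      rw [Finset.sum_filter, Finset.mul_sum]
      refine Finset.sum_congr rfl fun f hf => ?_
      rw [← he.2]
      simp only [hc e he.1 f hf, eq_comm, mul_ite, mul_zero]
    rw [Finset.sum_congr rfl h1]
    exact (Finset.sum_fiberwise_of_maps_to (fun e he => Finset.mem_image_of_mem c he) _).symm
  rw [this]
  exact Finset.sum_nonneg fun _ _ => sq_nonneg _

end LinearAlgebra

/-! ### Hessians of links in a system of bases. -/

section BasisSystem

open Matrix

variable {σ : Type*} [DecidableEq σ]

/-- The Hessian matrix at the all-one vector of the generating function of the link of `S` in a set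
system `𝓑`: its entry at distinct `e, f ∉ S` is the number of members of `𝓑` containing `S`, `e`
and `f`, and its other entries vanish. -/
def linkHessian (R : Type*) [Semiring R] (𝓑 : Finset (Finset σ)) (S : Finset σ) : Matrix σ σ R :=
  of fun e f => ∑ B ∈ 𝓑 with S ⊆ B, if e ∈ B \ S ∧ f ∈ B \ S ∧ e ≠ f then 1 else 0

/-- The sets contained in a member of `𝓑`. -/
def SubBasis {σ : Type*} (𝓑 : Finset (Finset σ)) (S : Finset σ) : Prop := ∃ B ∈ 𝓑, S ⊆ B

theorem SubBasis.subset {σ : Type*} {𝓑 : Finset (Finset σ)} {S T : Finset σ} (h : SubBasis 𝓑 T)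
    (hST : S ⊆ T) : SubBasis 𝓑 S :=
  let ⟨B, hB, hTB⟩ := h
  ⟨B, hB, hST.trans hTB⟩

theorem linkHessian_isSymm (R : Type*) [Semiring R] (𝓑 : Finset (Finset σ)) (S : Finset σ) :
    (linkHessian R 𝓑 S).IsSymm := by
  ext e f
  simp only [linkHessian, transpose_apply, of_apply]
  refine Finset.sum_congr rfl fun B _ => if_congr ?_ rfl rfl
  tauto

theorem linkHessian_nonneg (𝓑 : Finset (Finset σ)) (S : Finset σ) (e f : σ) :
    0 ≤ linkHessian ℝ 𝓑 S e f :=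
  Finset.sum_nonneg fun B _ => by split_ifs <;> simp

theorem linkHessian_ne_zero_iff {𝓑 : Finset (Finset σ)} {S : Finset σ} {e f : σ} :
    linkHessian ℝ 𝓑 S e f ≠ 0 ↔
      e ≠ f ∧ e ∉ S ∧ f ∉ S ∧ SubBasis 𝓑 (insert e (insert f S)) := by
  rw [linkHessian, of_apply, Ne,
    Finset.sum_eq_zero_iff_of_nonneg fun B _ => by split_ifs <;> simp]
  simp only [SubBasis, Finset.insert_subset_iff, Finset.mem_filter, Finset.mem_sdiff]
  push Not
  constructor
  · rintro ⟨B, ⟨hB, hS⟩, h⟩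
    have h2 := ite_ne_right_iff.1 h
    exact ⟨h2.1.2.2, h2.1.1.2, h2.1.2.1.2, B, hB, h2.1.1.1, h2.1.2.1.1, hS⟩
  · rintro ⟨hne, he, hf, B, hB, heB, hfB, hS⟩
    refine ⟨B, ⟨hB, hS⟩, ?_⟩
    rw [if_pos ⟨⟨heB, he⟩, ⟨hfB, hf⟩, hne⟩]
    exact one_ne_zero

/-- The augmentation axiom for the sets contained in a member of `𝓑`. -/
def Augmentable (𝓑 : Finset (Finset σ)) : Prop :=
  ∀ I J : Finset σ, SubBasis 𝓑 I → SubBasis 𝓑 J → I.card < J.card →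
    ∃ e ∈ J, e ∉ I ∧ SubBasis 𝓑 (insert e I)

/-- If `e, g` extend `S` to an independent set of larger rank, so does one of them together with
a nonloop `f`. -/
theorem Augmentable.linkHessian_ne_zero {𝓑 : Finset (Finset σ)} (haug : Augmentable 𝓑)
    {S : Finset σ} {e f g : σ} (heg : linkHessian ℝ 𝓑 S e g ≠ 0) (hf : f ∉ S)
    (hfS : SubBasis 𝓑 (insert f S)) :
    linkHessian ℝ 𝓑 S e f ≠ 0 ∨ linkHessian ℝ 𝓑 S g f ≠ 0 := by
  rw [linkHessian_ne_zero_iff] at heg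
  obtain ⟨hne, he, hg, hB⟩ := heg
  obtain ⟨x, hx, hxn, hxS⟩ := haug _ _ hfS hB (by
    rw [Finset.card_insert_of_notMem hf, Finset.card_insert_of_notMem (by simp [hne, he]),
      Finset.card_insert_of_notMem hg]
    omega)
  simp only [Finset.mem_insert, not_or] at hx hxn
  rw [linkHessian_ne_zero_iff, linkHessian_ne_zero_iff]
  rcases hx with rfl | rfl | hx
  · exact .inl ⟨hxn.1, he, hf, hxS⟩
  · exact .inr ⟨hxn.1, hg, hf, hxS⟩
  · exact absurd hx hxn.2

theorem exists_linkHessian_ne_zero {𝓑 : Finset (Finset σ)} {r : ℕ}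
    (hcard : ∀ B ∈ 𝓑, B.card = r) {S : Finset σ} (hS : S.card + 2 ≤ r) {e : σ} (he : e ∉ S)
    (h : SubBasis 𝓑 (insert e S)) : ∃ g, linkHessian ℝ 𝓑 S e g ≠ 0 := by
  obtain ⟨B, hB, hSB⟩ := h
  obtain ⟨g, hg, hgS⟩ := Finset.exists_mem_notMem_of_card_lt_card
    (s := insert e S) (t := B) (by rw [hcard B hB, Finset.card_insert_of_notMem he]; omega)
  simp only [Finset.mem_insert, not_or] at hgS
  refine ⟨g, linkHessian_ne_zero_iff.2 ⟨Ne.symm hgS.1, he, hgS.2, B, hB, ?_⟩⟩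
  rw [Finset.insert_subset_iff] at hSB ⊢
  exact ⟨hSB.1, Finset.insert_subset hg hSB.2⟩

/-- In corank two, `S`, `e` and `f` already make up a full basis, so only one basis is counted. -/
theorem linkHessian_apply_of_card {𝓑 : Finset (Finset σ)} {r : ℕ}
    (hcard : ∀ B ∈ 𝓑, B.card = r) {S : Finset σ} (hS : S.card + 2 = r) {e f : σ}
    (h : linkHessian ℝ 𝓑 S e f ≠ 0) : linkHessian ℝ 𝓑 S e f = 1 := by
  obtain ⟨hne, he, hf, B, hB, hSB⟩ := linkHessian_ne_zero_iff.1 h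
  have huniq : ∀ C ∈ 𝓑, insert e (insert f S) ⊆ C → C = insert e (insert f S) := by
    intro C hC hsub
    refine (Finset.eq_of_subset_of_card_le hsub ?_).symm
    rw [hcard C hC, Finset.card_insert_of_notMem (by simp [hne, he]),
      Finset.card_insert_of_notMem hf]
    omega
  have hB' := huniq B hB hSB
  rw [linkHessian, of_apply, Finset.sum_filter, Finset.sum_eq_single_of_mem B hB]
  · rw [Finset.insert_subset_iff, Finset.insert_subset_iff] at hSB
    simp [hSB, he, hf, hne]
  · intro C hC hCB
    rw [← ite_and]
    refine if_neg fun h => hCB ?_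
    rw [hB']
    refine huniq C hC ?_
    simp only [Finset.mem_sdiff] at h
    exact Finset.insert_subset h.2.1.1 (Finset.insert_subset h.2.2.1.1 h.1)

variable [Fintype σ]

/-- A basis through `S` and `e` is counted once for each of its `k` further elements. -/
theorem linkHessian_mulVec_one {𝓑 : Finset (Finset σ)} {r : ℕ} (hcard : ∀ B ∈ 𝓑, B.card = r)
    {S : Finset σ} {k : ℕ} (hk : S.card + (k + 1) = r) (e : σ) :
    (linkHessian ℝ 𝓑 S *ᵥ 1) e =
      k * ∑ B ∈ 𝓑 with S ⊆ B, if e ∈ B \ S then 1 else 0 := by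
  simp only [mulVec, dotProduct, linkHessian, of_apply, Pi.one_apply, mul_one]
  rw [Finset.sum_comm, Finset.mul_sum]
  refine Finset.sum_congr rfl fun B hB => ?_
  rw [Finset.mem_filter] at hB
  by_cases he : e ∈ B \ S
  · have : ∀ f, (e ∈ B \ S ∧ f ∈ B \ S ∧ e ≠ f) ↔ f ∈ (B \ S).erase e := by
      intro f
      rw [Finset.mem_erase]
      tauto
    simp only [this, Finset.sum_boole, if_pos he, mul_one]
    rw [Finset.filter_mem_eq_inter, Finset.univ_inter, Finset.card_erase_of_mem he,
      Finset.card_sdiff_of_subset hB.2, hcard B hB.1, ← hk]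
    congr 1
    omega
  · simp [he]

theorem linkHessian_insert_mulVec_one {𝓑 : Finset (Finset σ)} {r : ℕ}
    (hcard : ∀ B ∈ 𝓑, B.card = r) {S : Finset σ} {k : ℕ} (hk : S.card + (k + 2) = r) {g : σ}
    (hg : g ∉ S) (e : σ) :
    (linkHessian ℝ 𝓑 (insert g S) *ᵥ 1) e = k * linkHessian ℝ 𝓑 S g e := by
  rw [linkHessian_mulVec_one hcard (k := k) (by rw [Finset.card_insert_of_notMem hg]; omega)]
  congr 1
  rw [linkHessian, of_apply, Finset.sum_filter, Finset.sum_filter]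
  refine Finset.sum_congr rfl fun B _ => ?_
  simp only [← ite_and]
  refine if_congr ?_ rfl rfl
  simp only [Finset.insert_subset_iff, Finset.mem_sdiff, Finset.mem_insert, not_or]
  constructor
  · rintro ⟨⟨h1, h2⟩, h3, h4, h5⟩
    exact ⟨h2, ⟨h1, hg⟩, ⟨h3, h5⟩, Ne.symm h4⟩
  · rintro ⟨h2, ⟨h1, -⟩, ⟨h3, h5⟩, h4⟩
    exact ⟨⟨h1, h2⟩, h3, Ne.symm h4, h5⟩

theorem one_dotProduct_linkHessian_insert {𝓑 : Finset (Finset σ)} {r : ℕ}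
    (hcard : ∀ B ∈ 𝓑, B.card = r) {S : Finset σ} {k : ℕ} (hk : S.card + (k + 2) = r) {g : σ}
    (hg : g ∉ S) (v : σ → ℝ) :
    1 ⬝ᵥ linkHessian ℝ 𝓑 (insert g S) *ᵥ v = k * (linkHessian ℝ 𝓑 S *ᵥ v) g := by
  rw [(linkHessian_isSymm ℝ 𝓑 _).dotProduct_mulVec_comm]
  simp only [dotProduct, linkHessian_insert_mulVec_one hcard hk hg]
  simp only [mulVec, dotProduct, Finset.mul_sum]
  exact Finset.sum_congr rfl fun e _ => by ring

/-- Euler's relation: a basis containing `S`, `e`, `f` is counted once for each of its `k` remaining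
elements `g`. -/
theorem sum_linkHessian_insert {𝓑 : Finset (Finset σ)} {r : ℕ}
    (hcard : ∀ B ∈ 𝓑, B.card = r) {S : Finset σ} {k : ℕ} (hk : S.card + (k + 2) = r) :
    ∑ g ∈ Sᶜ, linkHessian ℝ 𝓑 (insert g S) = (k : ℝ) • linkHessian ℝ 𝓑 S := by
  ext e f
  rw [Matrix.sum_apply, Matrix.smul_apply, smul_eq_mul]
  simp only [linkHessian, of_apply]
  simp only [Finset.sum_filter]
  rw [Finset.sum_comm, Finset.mul_sum]
  refine Finset.sum_congr rfl fun B hB => ?_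
  by_cases hS : S ⊆ B
  swap
  · simp [hS, Finset.insert_subset_iff]
  simp only [hS, Finset.insert_subset_iff, and_true, true_and, ← ite_and]
  by_cases h : e ∈ B \ S ∧ f ∈ B \ S ∧ e ≠ f
  · have hsub : {e, f} ⊆ B \ S := by
      simp [Finset.insert_subset_iff, h.1, h.2.1]
    have h2 : ∀ g ∈ Sᶜ, (g ∈ B ∧ e ∈ B \ insert g S ∧ f ∈ B \ insert g S ∧ e ≠ f) ↔
        g ∈ (B \ S) \ {e, f} := by
      intro g hg
      simp only [Finset.mem_sdiff, Finset.mem_insert, Finset.mem_singleton, not_or,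
        Finset.mem_compl] at h hg ⊢
      constructor
      · rintro ⟨h1, ⟨_, h3, _⟩, ⟨_, h5, _⟩, _⟩
        exact ⟨⟨h1, hg⟩, Ne.symm h3, Ne.symm h5⟩
      · rintro ⟨⟨h1, _⟩, h3, h5⟩
        exact ⟨h1, ⟨h.1.1, Ne.symm h3, h.1.2⟩, ⟨h.2.1.1, Ne.symm h5, h.2.1.2⟩, h.2.2⟩
    rw [if_pos h, mul_one, Finset.sum_congr rfl fun g hg => if_congr (h2 g hg) rfl rfl,
      Finset.sum_boole, Finset.filter_mem_eq_inter, Finset.inter_eq_right.2,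
      Finset.card_sdiff_of_subset hsub,
      Finset.card_sdiff_of_subset hS, hcard B hB, Finset.card_pair h.2.2, ← hk]
    · congr 1
      omega
    · intro g hg
      simp only [Finset.mem_sdiff] at hg
      exact Finset.mem_compl.2 hg.1.2
  · rw [if_neg h, mul_zero]
    refine Finset.sum_eq_zero fun g _ => if_neg fun h2 => h ?_
    simp only [Finset.mem_sdiff, Finset.mem_insert, not_or] at h2 ⊢
    exact ⟨⟨h2.2.1.1, h2.2.1.2.2⟩, ⟨h2.2.2.1.1, h2.2.2.1.2.2⟩, h2.2.2.2⟩

theorem sum_quadForm_linkHessian_insert {𝓑 : Finset (Finset σ)} {r : ℕ}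
    (hcard : ∀ B ∈ 𝓑, B.card = r) {S : Finset σ} {k : ℕ} (hk : S.card + (k + 2) = r)
    (v : σ → ℝ) :
    ∑ g ∈ Sᶜ, v ⬝ᵥ linkHessian ℝ 𝓑 (insert g S) *ᵥ v = k * (v ⬝ᵥ linkHessian ℝ 𝓑 S *ᵥ v) := by
  rw [← dotProduct_sum, ← Matrix.sum_mulVec, sum_linkHessian_insert hcard hk, smul_mulVec,
    dotProduct_smul, smul_eq_mul]

theorem one_dotProduct_linkHessian_nonneg (𝓑 : Finset (Finset σ)) (S : Finset σ) :
    0 ≤ 1 ⬝ᵥ linkHessian ℝ 𝓑 S *ᵥ (1 : σ → ℝ) := by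
  simp only [dotProduct, mulVec, Pi.one_apply, one_mul, mul_one]
  exact Finset.sum_nonneg fun e _ => Finset.sum_nonneg fun f _ => linkHessian_nonneg 𝓑 S e f

theorem linkHessian_eq_zero_or_pos (𝓑 : Finset (Finset σ)) (S : Finset σ) :
    linkHessian ℝ 𝓑 S = 0 ∨ 0 < 1 ⬝ᵥ linkHessian ℝ 𝓑 S *ᵥ (1 : σ → ℝ) := by
  rcases (one_dotProduct_linkHessian_nonneg 𝓑 S).eq_or_lt with h | h
  · left
    ext e f
    simp only [dotProduct, mulVec, Pi.one_apply, one_mul, mul_one] at h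
    have h1 := (Finset.sum_eq_zero_iff_of_nonneg fun e _ => Finset.sum_nonneg fun f _ =>
      linkHessian_nonneg 𝓑 S e f).1 h.symm e (Finset.mem_univ e)
    exact (Finset.sum_eq_zero_iff_of_nonneg fun f _ => linkHessian_nonneg 𝓑 S e f).1 h1 f
      (Finset.mem_univ f)
  · exact .inr h

theorem subBasis_of_linkHessian_mulVec_ne_zero {𝓑 : Finset (Finset σ)} {S : Finset σ} {e : σ}
    {v : σ → ℝ} (h : (linkHessian ℝ 𝓑 S *ᵥ v) e ≠ 0) : e ∉ S ∧ SubBasis 𝓑 (insert e S) := by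
  obtain ⟨f, -, hf⟩ := Finset.exists_ne_zero_of_sum_ne_zero h
  obtain ⟨-, he, -, hB⟩ := linkHessian_ne_zero_iff.1 (left_ne_zero_of_mul hf)
  exact ⟨he, hB.subset (Finset.insert_subset_insert _ (Finset.subset_insert _ _))⟩

/-- Take an edge `e`–`g` of the support graph: augmentation joins any nonloop `f` to `e` or to `g`,
so `e` and `f` are at distance at most two. -/
theorem Augmentable.linkHessian_connected {𝓑 : Finset (Finset σ)} (haug : Augmentable 𝓑) {r : ℕ}
    (hcard : ∀ B ∈ 𝓑, B.card = r) {S : Finset σ} (hS : S.card + 2 ≤ r) (z : σ → ℝ)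
    (hz : ∀ e f, linkHessian ℝ 𝓑 S e f ≠ 0 → z e = z f) :
    ∃ c, ∀ e, (linkHessian ℝ 𝓑 S *ᵥ 1) e ≠ 0 → z e = c := by
  by_cases hex : ∃ f, (linkHessian ℝ 𝓑 S *ᵥ 1) f ≠ 0
  · obtain ⟨f, hf⟩ := hex
    obtain ⟨hfS, hfB⟩ := subBasis_of_linkHessian_mulVec_ne_zero hf
    refine ⟨z f, fun e he => ?_⟩
    obtain ⟨heS, heB⟩ := subBasis_of_linkHessian_mulVec_ne_zero he
    obtain ⟨g, hg⟩ := exists_linkHessian_ne_zero hcard hS heS heB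
    rcases haug.linkHessian_ne_zero hg hfS hfB with h | h
    · exact hz _ _ h
    · exact (hz _ _ hg).trans (hz _ _ h)
  · push Not at hex
    exact ⟨0, fun e he => absurd (hex e) he⟩

/-- In rank two the graph of bases is complete multipartite. -/
theorem Augmentable.quadForm_linkHessian_le {𝓑 : Finset (Finset σ)} (haug : Augmentable 𝓑) {r : ℕ}
    (hcard : ∀ B ∈ 𝓑, B.card = r) {S : Finset σ} (hS : S.card + 2 = r) (s : Finset σ)
    (hs : ∀ e, e ∈ s ↔ e ∉ S ∧ SubBasis 𝓑 (insert e S)) (v : σ → ℝ) :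
    v ⬝ᵥ linkHessian ℝ 𝓑 S *ᵥ v ≤ (∑ e ∈ s, v e) ^ 2 := by
  classical
  set H := linkHessian ℝ 𝓑 S with hH
  have hsymm : ∀ e f, H e f = H f e := fun e f => (linkHessian_isSymm ℝ 𝓑 S).apply f e
  have hoff : ∀ e f, H e f ≠ 0 → e ∈ s := by
    intro e f h
    obtain ⟨-, he, -, hB⟩ := linkHessian_ne_zero_iff.1 h
    exact (hs e).2 ⟨he, hB.subset (Finset.insert_subset_insert _ (Finset.subset_insert _ _))⟩
  -- Parallelism. The first condition keeps `R` transitive on the whole type, because elements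
  -- outside `s` have zero rows.
  let R : σ → σ → Prop := fun e f => (e ∈ s ↔ f ∈ s) ∧ H e f = 0
  have hR : Equivalence R := by
    refine ⟨fun e => ⟨Iff.rfl, ?_⟩, fun {e f} h => ⟨h.1.symm, hsymm e f ▸ h.2⟩, ?_⟩
    · by_contra h
      exact (linkHessian_ne_zero_iff.1 h).1 rfl
    · intro e f g h1 h2
      refine ⟨h1.1.trans h2.1, ?_⟩
      by_contra h
      have hf := (hs f).1 (h1.1.1 (hoff e g h))
      rcases haug.linkHessian_ne_zero h hf.1 hf.2 with h3 | h3
      · exact h3 h1.2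
      · exact h3 (by rw [← hH, hsymm]; exact h2.2)
  have hQ : v ⬝ᵥ H *ᵥ v = ∑ e ∈ s, ∑ f ∈ s, H e f * (v e * v f) := by
    simp only [dotProduct, mulVec, Finset.mul_sum]
    rw [← Finset.sum_subset (Finset.subset_univ s)]
    · refine Finset.sum_congr rfl fun e _ => ?_
      rw [← Finset.sum_subset (Finset.subset_univ s)]
      · exact Finset.sum_congr rfl fun f _ => by ring
      · intro f _ hf
        have h0 : H e f = 0 := not_not.1 fun h => hf (hoff f e (by rwa [hsymm]))
        rw [h0, zero_mul, mul_zero]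
    · intro e _ he
      refine Finset.sum_eq_zero fun f _ => ?_
      have h0 : H e f = 0 := not_not.1 fun h => he (hoff e f h)
      rw [h0, zero_mul, mul_zero]
  have hpos := sum_equivalence_mul_nonneg s R hR v
  -- On `s` the matrix is all ones minus the indicator of parallelism.
  have : ∑ e ∈ s, ∑ f ∈ s, (if R e f then v e * v f else 0) =
      (∑ e ∈ s, v e) ^ 2 - v ⬝ᵥ H *ᵥ v := by
    rw [hQ, sq, Finset.sum_mul_sum, ← Finset.sum_sub_distrib]
    refine Finset.sum_congr rfl fun e he => ?_
    rw [← Finset.sum_sub_distrib]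
    refine Finset.sum_congr rfl fun f hf => ?_
    by_cases h : H e f = 0
    · rw [if_pos ⟨by simp [he, hf], h⟩, h]; ring
    · have h1 : H e f = 1 := linkHessian_apply_of_card hcard hS h
      rw [if_neg fun h2 => h h2.2, h1]; ring
  linarith

/-- Induction on the corank `k + 2` of `S`: rank two is the multipartite case, and the step sums the
inequalities of the links of `insert g S` to obtain the trickle-down hypothesis. -/
theorem Augmentable.reverseCauchySchwarz {𝓑 : Finset (Finset σ)} (haug : Augmentable 𝓑) {r : ℕ}
    (hcard : ∀ B ∈ 𝓑, B.card = r) {k : ℕ} {S : Finset σ} (hk : S.card + (k + 2) = r) :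
    ReverseCauchySchwarz (linkHessian ℝ 𝓑 S) := by
  classical
  induction k generalizing S with
  | zero =>
    rcases linkHessian_eq_zero_or_pos 𝓑 S with h | hT
    · intro v; simp [h]
    refine reverseCauchySchwarz_of_le_sq (linkHessian_isSymm ℝ 𝓑 S) hT
      (fun e => if e ∉ S ∧ SubBasis 𝓑 (insert e S) then 1 else 0) fun v => ?_
    refine (haug.quadForm_linkHessian_le hcard hk {e | e ∉ S ∧ SubBasis 𝓑 (insert e S)}
      (by simp) v).trans_eq ?_
    simp [dotProduct, Finset.sum_filter]
  | succ k ih =>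
    rcases linkHessian_eq_zero_or_pos 𝓑 S with h | hT
    · intro v; simp [h]
    refine reverseCauchySchwarz_of_trickle (linkHessian_isSymm ℝ 𝓑 S) (linkHessian_nonneg 𝓑 S) hT
      (haug.linkHessian_connected hcard (by omega)) fun y => ?_
    have hkpos : (0 : ℝ) < (k + 1 : ℕ) := by positivity
    rw [← mul_le_mul_iff_right₀ hkpos, ← sum_quadForm_linkHessian_insert hcard hk, Finset.mul_sum]
    set d := linkHessian ℝ 𝓑 S *ᵥ (1 : σ → ℝ) with hd
    have hdnn : ∀ g, 0 ≤ d g := fun g => Finset.sum_nonneg fun f _ => by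
      simpa using linkHessian_nonneg 𝓑 S g f
    refine (Finset.sum_le_sum fun g hg => ?_).trans
      (Finset.sum_le_sum_of_subset_of_nonneg (Finset.subset_univ Sᶜ) fun g _ _ =>
        mul_nonneg hkpos.le (div_nonneg (sq_nonneg ((linkHessian ℝ 𝓑 S *ᵥ y) g)) (hdnn g)))
    have hgS : g ∉ S := Finset.mem_compl.1 hg
    rcases linkHessian_eq_zero_or_pos 𝓑 (insert g S) with h | hTg
    · rw [h, zero_mulVec, dotProduct_zero]
      exact mul_nonneg hkpos.le (div_nonneg (sq_nonneg _) (hdnn g))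
    -- The link inequality reads Q_g(y) · (k+1) d_g ≤ ((k+1) (H y)_g)²; one factor k+1 cancels.
    · have h1 := ih (S := insert g S) (by rw [Finset.card_insert_of_notMem hgS]; omega) y
      rw [one_dotProduct_linkHessian_insert hcard hk hgS,
        one_dotProduct_linkHessian_insert hcard hk hgS, ← hd] at h1
      rw [one_dotProduct_linkHessian_insert hcard hk hgS, ← hd] at hTg
      have hdg : 0 < d g := pos_of_mul_pos_right hTg hkpos.le
      rw [← mul_div_assoc, le_div_iff₀ hdg, ← mul_le_mul_iff_right₀ hkpos]
      nlinarith [h1]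

/-- The kernel of the Hessian is contained in the kernels of the Hessians of the links. -/
theorem Augmentable.linkHessian_insert_mulVec_eq_zero {𝓑 : Finset (Finset σ)}
    (haug : Augmentable 𝓑) {r : ℕ} (hcard : ∀ B ∈ 𝓑, B.card = r) {k : ℕ} {S : Finset σ}
    (hk : S.card + (k + 3) = r) {v : σ → ℝ} (hv : linkHessian ℝ 𝓑 S *ᵥ v = 0) {g : σ}
    (hg : g ∉ S) : linkHessian ℝ 𝓑 (insert g S) *ᵥ v = 0 := by
  have hl : ∀ g ∈ Sᶜ, 1 ⬝ᵥ linkHessian ℝ 𝓑 (insert g S) *ᵥ v = 0 := by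
    intro g hg
    rw [one_dotProduct_linkHessian_insert (k := k + 1) hcard hk (Finset.mem_compl.1 hg), hv,
      Pi.zero_apply, mul_zero]
  have hP : ∀ g ∈ Sᶜ, ReverseCauchySchwarz (linkHessian ℝ 𝓑 (insert g S)) := fun g hg =>
    haug.reverseCauchySchwarz hcard (k := k)
      (by rw [Finset.card_insert_of_notMem (Finset.mem_compl.1 hg)]; omega)
  have hQ : ∀ g ∈ Sᶜ, v ⬝ᵥ linkHessian ℝ 𝓑 (insert g S) *ᵥ v ≤ 0 := by
    intro g hg
    rcases linkHessian_eq_zero_or_pos 𝓑 (insert g S) with h | hT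
    · simp [h]
    · have := hP g hg v
      rw [hl g hg] at this
      exact nonpos_of_mul_nonpos_left (by simpa using this) hT
  have hsum := sum_quadForm_linkHessian_insert (k := k + 1) hcard hk v
  rw [hv, dotProduct_zero, mul_zero] at hsum
  have hg' := Finset.mem_compl.2 hg
  rcases linkHessian_eq_zero_or_pos 𝓑 (insert g S) with h | hT
  · simp [h]
  · exact (hP g hg').mulVec_eq_zero (linkHessian_isSymm ℝ 𝓑 _) hT (hl g hg')
      ((Finset.sum_eq_zero_iff_of_nonpos hQ).1 hsum g hg')

theorem Augmentable.linkHessian_mulVec_eq_zero {𝓑 : Finset (Finset σ)}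
    (haug : Augmentable 𝓑) {r : ℕ} (hcard : ∀ B ∈ 𝓑, B.card = r) {v : σ → ℝ}
    (hv : linkHessian ℝ 𝓑 ∅ *ᵥ v = 0) {S : Finset σ} (hS : S.card + 2 ≤ r) :
    linkHessian ℝ 𝓑 S *ᵥ v = 0 := by
  induction S using Finset.induction_on with
  | empty => exact hv
  | insert g S hg ih =>
    rw [Finset.card_insert_of_notMem hg] at hS
    exact haug.linkHessian_insert_mulVec_eq_zero hcard (k := r - (S.card + 3)) (by omega)
      (ih (by omega)) hg

/-- A vector in the kernel of the Hessian vanishes at `e` if some flat of corank two has `{e}` as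
a parallel class of its contraction. -/
theorem Augmentable.apply_eq_zero_of_linkHessian_mulVec {𝓑 : Finset (Finset σ)}
    (haug : Augmentable 𝓑) {r : ℕ} (hcard : ∀ B ∈ 𝓑, B.card = r) {v : σ → ℝ}
    (hv : linkHessian ℝ 𝓑 ∅ *ᵥ v = 0) {S : Finset σ} (hS : S.card + 2 = r) {e g : σ}
    (heg : linkHessian ℝ 𝓑 S e g ≠ 0)
    (he : ∀ f, f ∉ S → f ≠ e → SubBasis 𝓑 (insert f S) → linkHessian ℝ 𝓑 S e f ≠ 0) :
    v e = 0 := by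
  classical
  have hv' := haug.linkHessian_mulVec_eq_zero hcard hv hS.le
  set H := linkHessian ℝ 𝓑 S with hH
  have hsymm : H.IsSymm := linkHessian_isSymm ℝ 𝓑 S
  let s : Finset σ := {e | e ∉ S ∧ SubBasis 𝓑 (insert e S)}
  have hs : ∀ e, e ∈ s ↔ e ∉ S ∧ SubBasis 𝓑 (insert e S) := by simp [s]
  have hdiag : ∀ x, H x x = 0 := fun x => by
    by_contra h
    exact (linkHessian_ne_zero_iff.1 h).1 rfl
  have hmem : ∀ x y, H x y ≠ 0 → x ∈ s := by
    intro x y h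
    obtain ⟨-, h1, -, hB⟩ := linkHessian_ne_zero_iff.1 h
    exact (hs x).2 ⟨h1, hB.subset (Finset.insert_subset_insert _ (Finset.subset_insert _ _))⟩
  have hes : e ∈ s := hmem e g heg
  have hgs : g ∈ s := hmem g e (by rw [hsymm.apply]; exact heg)
  have heg1 : H e g = 1 := linkHessian_apply_of_card hcard hS heg
  have hV : ∑ x ∈ s, v x = 0 := by
    set V := ∑ x ∈ s, v x with hVdef
    -- The test vector has sum zero over `s`, so its form is at most 0; as `v` is in the kernel, the
    -- form equals 2 (V/2)², whence V = 0.
    have h1 := haug.quadForm_linkHessian_le hcard hS s hs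
      (v + (-(V / 2)) • (Pi.single e 1 + Pi.single g 1))
    rw [quadForm_add_smul hsymm, hv', hsymm.dotProduct_mulVec_comm v, hv'] at h1
    have h2 : (Pi.single e 1 + Pi.single g 1) ⬝ᵥ H *ᵥ (Pi.single e 1 + Pi.single g 1 : σ → ℝ) =
        2 := by
      simp [mulVec_add, hdiag, heg1, hsymm.apply e g]
      norm_num
    have h3 : ∑ x ∈ s, (v + (-(V / 2)) • (Pi.single e 1 + Pi.single g 1) : σ → ℝ) x = 0 := by
      simp [Finset.sum_add_distrib, ← Finset.mul_sum, hes, hgs, ← hVdef]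
      ring
    rw [h2, h3] at h1
    simp only [dotProduct_zero] at h1
    nlinarith [sq_nonneg V]
  -- Row `e` is 1 at every nonloop other than `e`, since `e` is alone in its parallel class.
  have hrow : (H *ᵥ v) e = ∑ x ∈ s, v x - v e := by
    rw [← Finset.sum_erase_eq_sub hes, mulVec, dotProduct,
      ← Finset.sum_subset (Finset.subset_univ (s.erase e))]
    · refine Finset.sum_congr rfl fun f hf => ?_
      rw [Finset.mem_erase, hs] at hf
      have h1 : H e f = 1 := linkHessian_apply_of_card hcard hS (he f hf.2.1 hf.1 hf.2.2)
      rw [h1, one_mul]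
    · intro f _ hf
      have h0 : H e f = 0 := not_not.1 fun h : H e f ≠ 0 => hf (Finset.mem_erase.2
        ⟨(linkHessian_ne_zero_iff.1 h).1.symm, hmem f e (by rw [hsymm.apply]; exact h)⟩)
      rw [h0, zero_mul]
  rw [hv', Pi.zero_apply, hV] at hrow
  linarith

end BasisSystem

/-! ### From the Hessian to the algebra A. -/

namespace TruncMatroid

section Algebra

open Matrix

open MvPolynomial

variable {K : Type*} [Field K] {σ : Type*}

theorem pderiv_prod_X_of_notMem {i : σ} {B : Finset σ} (h : i ∉ B) :
    pderiv i (∏ b ∈ B, X b : MvPolynomial σ K) = 0 := by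
  classical
  induction B using Finset.induction_on with
  | empty => simp
  | insert b B hb ih =>
    rw [Finset.mem_insert, not_or] at h
    rw [Finset.prod_insert hb, Derivation.leibniz, ih h.2, pderiv_X_of_ne (Ne.symm h.1)]
    simp

theorem pderiv_prod_X [DecidableEq σ] (i : σ) (B : Finset σ) :
    pderiv i (∏ b ∈ B, X b : MvPolynomial σ K) =
      if i ∈ B then ∏ b ∈ B.erase i, X b else 0 := by
  split_ifs with h
  · rw [← Finset.mul_prod_erase B _ h, Derivation.leibniz,
      pderiv_prod_X_of_notMem (Finset.notMem_erase i B), pderiv_X_self]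
    simp
  · exact pderiv_prod_X_of_notMem h

/-- The factorial counts the orders in which the `k` variables can be differentiated away. -/
theorem diffOp_sum_X_pow_prod_X [Fintype σ] {k : ℕ} {B : Finset σ} (hB : B.card = k) :
    diffOp K σ ((∑ i, X i) ^ k) (∏ b ∈ B, X b) = C (k.factorial : K) := by
  classical
  induction k generalizing B with
  | zero => simp [Finset.card_eq_zero.1 hB]
  | succ k ih =>
    have h1 : diffOp K σ (∑ i, X i) (∏ b ∈ B, X b) = ∑ i ∈ B, ∏ b ∈ B.erase i, X b := by
      rw [map_sum, LinearMap.sum_apply]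
      simp only [diffOp_X, pderiv_prod_X]
      rw [Finset.sum_ite_mem, Finset.univ_inter]
    rw [pow_succ, map_mul, Module.End.mul_apply, h1, map_sum,
      Finset.sum_congr rfl fun i hi => ih (by rw [Finset.card_erase_of_mem hi, hB]; rfl),
      Finset.sum_const, hB, Nat.factorial_succ]
    simp

theorem diffOp_X_mul_X_mul_sum_X_pow [Fintype σ] [DecidableEq σ] {𝓑 : Finset (Finset σ)} {k : ℕ}
    (hcard : ∀ B ∈ 𝓑, B.card = k + 2) (e f : σ) :
    diffOp K σ (X f * ((∑ i, X i) ^ k * X e)) (∑ B ∈ 𝓑, ∏ b ∈ B, X b) =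
      C ((k.factorial : K) * linkHessian K 𝓑 ∅ f e) := by
  rw [mul_left_comm, mul_comm (X f), map_mul, map_mul, Module.End.mul_apply, Module.End.mul_apply,
    diffOp_X, diffOp_X, map_sum, map_sum, map_sum, linkHessian, of_apply, Finset.filter_true_of_mem
      (fun B _ => Finset.empty_subset B), Finset.mul_sum, map_sum]
  refine Finset.sum_congr rfl fun B hB => ?_
  simp only [Finset.sdiff_empty]
  rw [pderiv_prod_X]
  by_cases hf : f ∈ B
  · rw [if_pos hf, pderiv_prod_X]
    by_cases he : e ∈ B.erase f
    · rw [if_pos he, diffOp_sum_X_pow_prod_X]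
      · rw [Finset.mem_erase] at he
        rw [if_pos ⟨hf, he.2, Ne.symm he.1⟩, mul_one]
      · rw [Finset.card_erase_of_mem he, Finset.card_erase_of_mem hf, hcard B hB]
        rfl
    · rw [if_neg he, map_zero, if_neg, mul_zero, map_zero]
      rintro ⟨-, h1, h2⟩
      exact he (Finset.mem_erase.2 ⟨h2.symm, h1⟩)
  · simp [hf]

/-- Degree `k` polynomials are spanned by products of `k` linear forms, each lowering the degree by
one. Truncated subtraction is harmless: derivatives of constants are zero. -/
theorem IsHomogeneous.diffOp {n k : ℕ} {P F : MvPolynomial σ K} (hP : P.IsHomogeneous k)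
    (hF : F.IsHomogeneous n) : (diffOp K σ P F).IsHomogeneous (n - k) := by
  have hone : ∀ m, ∀ P ∈ homogeneousSubmodule σ K 1, ∀ F : MvPolynomial σ K, F.IsHomogeneous m →
      (TruncMatroid.diffOp K σ P F).IsHomogeneous (m - 1) := by
    intro m P hP F hF
    rw [homogeneousSubmodule_one_eq_span_X] at hP
    induction hP using Submodule.span_induction with
    | mem P h =>
      obtain ⟨i, rfl⟩ := h
      rw [diffOp_X]
      exact hF.pderiv
    | zero => rw [map_zero]; exact isHomogeneous_zero _ _ _
    | add P Q _ _ h1 h2 => rw [map_add]; exact h1.add h2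
    | smul c P _ h => rw [map_smul]; exact (homogeneousSubmodule σ K (m - 1)).smul_mem c h
  have hP' : P ∈ homogeneousSubmodule σ K 1 ^ k := by
    rw [homogeneousSubmodule_one_pow]; exact hP
  clear hP
  induction hP' using Submodule.pow_induction_on_left' generalizing n F with
  | algebraMap c =>
    rw [AlgHom.commutes, Module.algebraMap_end_apply]
    exact (homogeneousSubmodule σ K n).smul_mem c hF
  | add P Q k _ _ h1 h2 => rw [map_add]; exact (h1 hF).add (h2 hF)
  | mem_mul P hP k Q _ ih =>
    rw [map_mul, Module.End.mul_apply]
    exact hone _ P hP _ (ih hF)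

theorem exists_eq_sum_smul_X [Fintype σ] {P : MvPolynomial σ K} (hP : P.IsHomogeneous 1) :
    ∃ c : σ → K, P = ∑ i, c i • X i := by
  have : P ∈ homogeneousSubmodule σ K 1 := hP
  rw [homogeneousSubmodule_one_eq_span_X, Submodule.mem_span_range_iff_exists_fun] at this
  obtain ⟨c, hc⟩ := this
  exact ⟨c, hc.symm⟩

theorem isHomogeneous_sum_smul_X [Fintype σ] (c : σ → K) :
    (∑ i, c i • X i : MvPolynomial σ K).IsHomogeneous 1 :=
  IsHomogeneous.sum _ _ _ fun i _ =>
    (homogeneousSubmodule σ K 1).smul_mem (c i) (isHomogeneous_X K i)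

theorem pderiv_sum_smul_X [Fintype σ] (c : σ → K) (f : σ) :
    pderiv f (∑ i, c i • X i : MvPolynomial σ K) = C (c f) := by
  classical
  simp [pderiv_X, Pi.single_apply, smul_eq_C_mul]

theorem isHomogeneous_sum_X [Fintype σ] :
    (∑ i, X i : MvPolynomial σ K).IsHomogeneous 1 :=
  IsHomogeneous.sum _ _ _ fun i _ => isHomogeneous_X K i

theorem isHomogeneous_sum_prod_X {𝓑 : Finset (Finset σ)} {r : ℕ}
    (hcard : ∀ B ∈ 𝓑, B.card = r) :
    (∑ B ∈ 𝓑, ∏ b ∈ B, X b : MvPolynomial σ K).IsHomogeneous r := by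
  refine IsHomogeneous.sum _ _ _ fun B hB => ?_
  have := IsHomogeneous.prod (R := K) B (fun b => X b) (fun _ => 1) fun b _ => isHomogeneous_X K b
  simpa [hcard B hB] using this

theorem diffOp_sum_X_pow_mul_linear [Fintype σ] [DecidableEq σ] {𝓑 : Finset (Finset σ)} {k : ℕ}
    (hcard : ∀ B ∈ 𝓑, B.card = k + 2) (c : σ → K) :
    diffOp K σ ((∑ i, X i) ^ k * ∑ i, c i • X i) (∑ B ∈ 𝓑, ∏ b ∈ B, X b) =
      ∑ f, ((k.factorial : K) * (linkHessian K 𝓑 ∅ *ᵥ c) f) • X f := by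
  have hL : ((∑ i, X i) ^ k : MvPolynomial σ K).IsHomogeneous k := by
    simpa using (isHomogeneous_sum_X (K := K) (σ := σ)).pow k
  have hhom := IsHomogeneous.diffOp (hL.mul (isHomogeneous_sum_smul_X c))
    (isHomogeneous_sum_prod_X (K := K) hcard)
  rw [show k + 2 - (k + 1) = 1 by omega] at hhom
  obtain ⟨b, hb⟩ := exists_eq_sum_smul_X hhom
  rw [hb]
  refine Finset.sum_congr rfl fun f _ => ?_
  congr 1
  apply C_injective σ K
  rw [← pderiv_sum_smul_X b, ← hb, ← diffOp_X, ← Module.End.mul_apply, ← map_mul]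
  have hsum : X f * ((∑ i, X i) ^ k * ∑ i, c i • X i : MvPolynomial σ K) =
      ∑ e, c e • (X f * ((∑ i, X i) ^ k * X e)) := by
    simp only [Finset.mul_sum, mul_smul_comm]
  rw [hsum, map_sum (diffOp K σ), LinearMap.sum_apply, mulVec, dotProduct, Finset.mul_sum, map_sum]
  refine Finset.sum_congr rfl fun e _ => ?_
  rw [map_smul, LinearMap.smul_apply, diffOp_X_mul_X_mul_sum_X_pow hcard, smul_eq_C_mul, ← map_mul]
  congr 1
  ring

theorem sumVars_eq [Fintype σ] (Φ : MvPolynomial σ K) :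
    sumVars Φ = Ideal.Quotient.mk (annIdeal Φ) (∑ i, X i) := by
  rw [sumVars]
  congr!

theorem mem_annIdeal {Φ P : MvPolynomial σ K} : P ∈ annIdeal Φ ↔ diffOp K σ P Φ = 0 :=
  Iff.rfl

theorem mem_gradedPiece {Φ : MvPolynomial σ K} {k : ℕ} {a : MvPolynomial σ K ⧸ annIdeal Φ} :
    a ∈ gradedPiece Φ k ↔
      ∃ P : MvPolynomial σ K, P.IsHomogeneous k ∧ Ideal.Quotient.mk (annIdeal Φ) P = a :=
  Iff.rfl

/-- If the Hessian of the generating function of `𝓑` at the all-one vector is nonsingular, then the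
sum of the variables is a strong Lefschetz element in degree one. -/
theorem bijOn_sumVars_pow_mul [Fintype σ] [DecidableEq σ] [CharZero K] {𝓑 : Finset (Finset σ)}
    {k : ℕ} (hcard : ∀ B ∈ 𝓑, B.card = k + 2) (hdet : (linkHessian K 𝓑 ∅).det ≠ 0)
    {Φ : MvPolynomial σ K} (hΦ : Φ = ∑ B ∈ 𝓑, ∏ b ∈ B, X b) :
    Set.BijOn (fun a => sumVars Φ ^ k * a) (gradedPiece Φ 1) (gradedPiece Φ (k + 1)) := by
  have hunit : IsUnit (linkHessian K 𝓑 ∅) := (isUnit_iff_isUnit_det _).2 hdet.isUnit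
  have hkf : (k.factorial : K) ≠ 0 := Nat.cast_ne_zero.2 k.factorial_ne_zero
  have hL : ((∑ i, X i) ^ k : MvPolynomial σ K).IsHomogeneous k := by
    simpa using (isHomogeneous_sum_X (K := K) (σ := σ)).pow k
  have hmk : ∀ P, sumVars Φ ^ k * Ideal.Quotient.mk (annIdeal Φ) P =
      Ideal.Quotient.mk (annIdeal Φ) ((∑ i, X i) ^ k * P) := by
    intro P
    rw [sumVars_eq, map_mul, map_pow]
  have hkey : ∀ c : σ → K, diffOp K σ ((∑ i, X i) ^ k * ∑ i, c i • X i) Φ =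
      ∑ f, ((k.factorial : K) * (linkHessian K 𝓑 ∅ *ᵥ c) f) • X f := by
    rw [hΦ]
    exact diffOp_sum_X_pow_mul_linear hcard
  refine ⟨?_, ?_, ?_⟩
  · rintro _ ⟨P, hP, rfl⟩
    refine mem_gradedPiece.2 ⟨(∑ i, X i) ^ k * P, hL.mul hP, (hmk P).symm⟩
  · rintro _ ⟨P, hP, rfl⟩ _ ⟨Q, hQ, rfl⟩ hPQ
    obtain ⟨c, hc⟩ := exists_eq_sum_smul_X (IsHomogeneous.sub hP hQ)
    have h1 : (∑ i, X i) ^ k * (P - Q) ∈ annIdeal Φ := by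
      rw [mul_sub]
      refine (Ideal.Quotient.mk_eq_mk_iff_sub_mem _ _).1 ?_
      rw [← hmk, ← hmk]
      exact hPQ
    rw [hc, mem_annIdeal, hkey] at h1
    have h2 : linkHessian K 𝓑 ∅ *ᵥ c = 0 := by
      ext f
      have := congrArg (pderiv f) h1
      rw [pderiv_sum_smul_X, map_zero, ← C_0] at this
      exact (mul_eq_zero.1 (C_injective σ K this)).resolve_left hkf
    have h3 : c = 0 := mulVec_injective_of_isUnit hunit (by simpa using h2)
    have h4 : P = Q := sub_eq_zero.1 (by rw [hc, h3]; simp)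
    rw [h4]
  -- A class in A is determined by its action on Φ; here that is a linear form with coefficients
  -- `b`, so it remains to solve k! H c = b.
  · rintro _ ⟨P, hP, rfl⟩
    have hhom := IsHomogeneous.diffOp (K := K) hP (isHomogeneous_sum_prod_X (K := K) hcard)
    rw [show k + 2 - (k + 1) = 1 by omega, ← hΦ] at hhom
    obtain ⟨b, hb⟩ := exists_eq_sum_smul_X hhom
    obtain ⟨c, hc⟩ := (mulVec_surjective_iff_isUnit.2 hunit) (fun f => (k.factorial : K)⁻¹ * b f)
    refine ⟨Ideal.Quotient.mk (annIdeal Φ) (∑ i, c i • X i),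
      mem_gradedPiece.2 ⟨_, isHomogeneous_sum_smul_X c, rfl⟩, ?_⟩
    refine (hmk _).trans ((Ideal.Quotient.mk_eq_mk_iff_sub_mem _ _).2 ?_)
    rw [mem_annIdeal, map_sub, LinearMap.sub_apply, hkey, hb, hc, sub_eq_zero]
    exact Finset.sum_congr rfl fun f _ => by rw [mul_inv_cancel_left₀ hkf]

theorem linkHessian_eq_map_int (R : Type*) [CommRing R] [Fintype σ] [DecidableEq σ]
    (𝓑 : Finset (Finset σ)) (S : Finset σ) :
    linkHessian R 𝓑 S = (Int.castRingHom R).mapMatrix (linkHessian ℤ 𝓑 S) := by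
  ext e f
  simp [linkHessian]

/-- The entries are integers, so the determinant is the image of one integer in both ℝ and K; this
transfers the real argument to any field of characteristic zero. -/
theorem det_linkHessian_ne_zero [Fintype σ] [DecidableEq σ] [CharZero K] {𝓑 : Finset (Finset σ)}
    {S : Finset σ} (h : ∀ v, linkHessian ℝ 𝓑 S *ᵥ v = 0 → v = 0) :
    (linkHessian K 𝓑 S).det ≠ 0 := by
  have hR : (linkHessian ℝ 𝓑 S).det ≠ 0 := by
    intro h0
    obtain ⟨v, hv, hv0⟩ := exists_mulVec_eq_zero_iff.2 h0
    exact hv (h v hv0)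
  have hZ : (linkHessian ℤ 𝓑 S).det ≠ 0 := by
    intro h0
    refine hR ?_
    rw [linkHessian_eq_map_int, ← RingHom.map_det, h0, map_zero]
  rw [linkHessian_eq_map_int, ← RingHom.map_det]
  simpa using hZ

end Algebra

end TruncMatroid

/-! ### Bases of matroids and truncations as a finite set system. -/

namespace TruncMatroid

section Bases

variable {σ : Type*} [Fintype σ]

open scoped Classical in
/-- The finset of the bases of a matroid on a finite type. -/
noncomputable def baseFinset (M : Matroid σ) : Finset (Finset σ) :=
  {B | M.IsBase (B : Set σ)}

theorem mem_baseFinset {M : Matroid σ} {B : Finset σ} :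
    B ∈ baseFinset M ↔ M.IsBase (B : Set σ) := by
  simp [baseFinset]

theorem subBasis_baseFinset_iff {M : Matroid σ} {S : Finset σ} :
    SubBasis (baseFinset M) S ↔ M.Indep (S : Set σ) := by
  classical
  constructor
  · rintro ⟨B, hB, hSB⟩
    exact (mem_baseFinset.1 hB).indep.subset (Finset.coe_subset.2 hSB)
  · intro h
    obtain ⟨B, hB, hSB⟩ := h.exists_isBase_superset
    refine ⟨B.toFinset, mem_baseFinset.2 (by simpa using hB), ?_⟩
    rw [← Finset.coe_subset, Set.coe_toFinset]
    exact hSB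

theorem augmentable_baseFinset [DecidableEq σ] (M : Matroid σ) : Augmentable (baseFinset M) := by
  intro I J hI hJ hlt
  rw [subBasis_baseFinset_iff] at hI hJ
  obtain ⟨e, heJ, heI, he⟩ := hI.augment_finset hJ hlt
  refine ⟨e, heJ, heI, subBasis_baseFinset_iff.2 ?_⟩
  rwa [Finset.coe_insert]

theorem basisGenFun_eq (K : Type*) [Field K] (M : Matroid σ) :
    basisGenFun K M = ∑ B ∈ baseFinset M, ∏ b ∈ B, MvPolynomial.X b := by
  classical
  simp only [basisGenFun]
  -- The index set in `basisGenFun` elaborates to sets, as the image of the finsets under coercion,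
  -- so the two sums are matched through `Set.toFinset`.
  refine Finset.sum_nbij' (fun B => B.toFinset) (fun B => (B : Set σ)) ?_ ?_ ?_ ?_ ?_
  · intro B hB
    rw [mem_baseFinset, Set.coe_toFinset]
    exact (Finset.mem_filter.1 hB).2
  · intro B hB
    refine Finset.mem_filter.2 ⟨?_, mem_baseFinset.1 hB⟩
    simp only [Finset.bind_def, Finset.mem_sup, Finset.pure_def, Finset.mem_singleton]
    exact ⟨B, @Finset.mem_univ _ (_) B, rfl⟩
  · intro B _
    exact Set.coe_toFinset B
  · intro B _
    ext; simp
  · intro B _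
    congr!

theorem subBasis_truncation_iff {M : Matroid σ} {r : ℕ} {S : Finset σ} :
    SubBasis (baseFinset (truncation M r)) S ↔ M.Indep (S : Set σ) ∧ S.card ≤ r := by
  rw [subBasis_baseFinset_iff, truncation_indep_iff, Set.encard_coe_eq_coe_finsetCard,
    Nat.cast_le]

theorem card_of_mem_baseFinset_truncation {M : Matroid σ} {r : ℕ} (hr : (r : ℕ∞) ≤ M.eRank)
    {B : Finset σ} (hB : B ∈ baseFinset (truncation M r)) : B.card = r := by
  have h := ((truncation_isBase_iff M r hr _).1 (mem_baseFinset.1 hB)).1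
  rwa [Set.encard_coe_eq_coe_finsetCard, Nat.cast_inj] at h

end Bases

/-! ### Stars in the complete bipartite graph. -/

section CompleteBipartite

open Matrix

variable {m n : ℕ}

/-- The edge of the complete bipartite graph joining `i` to `j`. -/
def bipEdge (i : Fin m) (j : Fin n) : (completeBipartiteGraph (Fin m) (Fin n)).edgeSet :=
  ⟨s(.inl i, .inr j), .inl ⟨rfl, rfl⟩⟩

theorem bipEdge_inj {i i' : Fin m} {j j' : Fin n} :
    bipEdge i j = bipEdge i' j' ↔ i = i' ∧ j = j' := by
  rw [Subtype.ext_iff]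
  change s(Sum.inl i, Sum.inr j) = s(Sum.inl i', Sum.inr j') ↔ _
  simp

theorem exists_eq_bipEdge (e : (completeBipartiteGraph (Fin m) (Fin n)).edgeSet) :
    ∃ i j, e = bipEdge i j := by
  obtain ⟨e, he⟩ := e
  induction e with
  | h a b =>
    rcases a with i | j <;> rcases b with i' | j'
    · simp [completeBipartiteGraph] at he
    · exact ⟨i, j', rfl⟩
    · exact ⟨i', j, Subtype.ext Sym2.eq_swap⟩
    · simp [completeBipartiteGraph] at he

open scoped Classical in
/-- The edges joining `i` to the elements of `J`. -/
noncomputable def bipStar (i : Fin m) (J : Finset (Fin n)) :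
    Finset (completeBipartiteGraph (Fin m) (Fin n)).edgeSet :=
  J.image (bipEdge i)

theorem mem_bipStar {i : Fin m} {J : Finset (Fin n)}
    {e : (completeBipartiteGraph (Fin m) (Fin n)).edgeSet} :
    e ∈ bipStar i J ↔ ∃ j ∈ J, bipEdge i j = e := by
  simp [bipStar]

theorem bipEdge_mem_bipStar {i : Fin m} {j : Fin n} {J : Finset (Fin n)} :
    bipEdge i j ∈ bipStar i J ↔ j ∈ J := by
  simp [mem_bipStar, bipEdge_inj]

theorem card_bipStar (i : Fin m) (J : Finset (Fin n)) : (bipStar i J).card = J.card :=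
  Finset.card_image_of_injective _ fun _ _ h => (bipEdge_inj.1 h).2

theorem indep_bipStar (i : Fin m) (J : Finset (Fin n)) :
    (graphicMatroid (completeBipartiteGraph (Fin m) (Fin n))).Indep
      (bipStar i J : Set (completeBipartiteGraph (Fin m) (Fin n)).edgeSet) := by
  rw [graphicMatroid_indep_iff]
  refine (SimpleGraph.isAcyclic_starGraph (Sum.inl i)).anti ?_
  intro a b hab
  rw [edgeSubgraph, SimpleGraph.fromEdgeSet_adj] at hab
  obtain ⟨⟨e, he, heab⟩, hne⟩ := hab
  obtain ⟨j, -, rfl⟩ := mem_bipStar.1 he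
  rw [SimpleGraph.starGraph_adj]
  refine ⟨hne, ?_⟩
  rcases Sym2.eq_iff.1 heab with h | h
  · exact .inl h.1.symm
  · exact .inr h.1.symm

/-- Only `f` can meet the vertex `j`, and if it does, its other end `i' ≠ i` lies on no edge of the
star; so the component of `j` is at most {j, i'}. -/
theorem not_reachable_bipStar {i : Fin m} {j : Fin n} {J : Finset (Fin n)} (hj : j ∉ J)
    {f : (completeBipartiteGraph (Fin m) (Fin n)).edgeSet} (hf : f ≠ bipEdge i j) :
    ¬ (edgeSubgraph (completeBipartiteGraph (Fin m) (Fin n))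
      (insert f (bipStar i J : Set _))).Reachable (.inl i) (.inr j) := by
  intro h
  obtain ⟨p⟩ := h.symm
  obtain ⟨d, -, hd1, hd2⟩ := p.exists_boundary_dart
    {x | x = .inr j ∨ ∃ i', i' ≠ i ∧ x = .inl i' ∧ f = bipEdge i' j} (.inl rfl) (by
      rintro (h | ⟨i', hne, h, -⟩)
      · cases h
      · exact hne (Sum.inl_injective h).symm)
  obtain ⟨⟨e, he, hed⟩, -⟩ := (SimpleGraph.fromEdgeSet_adj _).1 d.adj
  rw [Set.mem_insert_iff, Finset.mem_coe, mem_bipStar] at he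
  obtain ⟨a, b, rfl⟩ := exists_eq_bipEdge e
  rcases hd1 with h1 | ⟨i', hne, h1, hfi⟩
  · rcases Sym2.eq_iff.1 hed with ⟨ha, hb⟩ | ⟨ha, hb⟩
    · rw [h1] at ha; cases ha
    · rw [h1] at hb
      cases hb
      rcases he with he | ⟨j', hj', he⟩
      · refine hd2 (.inr ⟨a, ?_, ha.symm, he.symm⟩)
        rintro rfl
        exact hf he.symm
      · rw [bipEdge_inj] at he
        exact hj (he.2 ▸ hj')
  · rcases Sym2.eq_iff.1 hed with ⟨ha, hb⟩ | ⟨ha, hb⟩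
    · rw [h1] at ha
      cases ha
      rcases he with he | ⟨j', hj', he⟩
      · rw [hfi, bipEdge_inj] at he
        exact hd2 (.inl (by rw [← hb, he.2]))
      · rw [bipEdge_inj] at he
        exact hne he.1.symm
    · rw [h1] at hb; cases hb

theorem indep_insert_bipEdge {i : Fin m} {j : Fin n} {J : Finset (Fin n)} (hj : j ∉ J)
    {f : (completeBipartiteGraph (Fin m) (Fin n)).edgeSet} (hf : f ≠ bipEdge i j)
    (h : (graphicMatroid (completeBipartiteGraph (Fin m) (Fin n))).Indep
      (insert f (bipStar i J : Set _))) :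
    (graphicMatroid (completeBipartiteGraph (Fin m) (Fin n))).Indep
      (insert (bipEdge i j) (insert f (bipStar i J : Set _))) := by
  rw [graphicMatroid_indep_iff] at h ⊢
  refine (h.sup_edge_of_not_reachable (not_reachable_bipStar hj hf)).anti ?_
  rw [edgeSubgraph, Set.image_insert_eq, Set.insert_eq, Set.union_comm,
    SimpleGraph.fromEdgeSet_union]
  exact le_rfl

open scoped Classical in
theorem linkHessian_completeBipartite_injective [Fintype
      (completeBipartiteGraph (Fin m) (Fin n)).edgeSet] {r : ℕ} (hr : 2 ≤ r) (hrn : r ≤ n)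
    (hcard : ∀ B ∈ baseFinset (truncation (graphicMatroid
      (completeBipartiteGraph (Fin m) (Fin n))) r), B.card = r)
    (v : (completeBipartiteGraph (Fin m) (Fin n)).edgeSet → ℝ)
    (hv : linkHessian ℝ (baseFinset (truncation (graphicMatroid
      (completeBipartiteGraph (Fin m) (Fin n))) r)) ∅ *ᵥ v = 0) : v = 0 := by
  ext e
  obtain ⟨i, j, rfl⟩ := exists_eq_bipEdge e
  -- Of r-1 columns other than `j`, all but `j'` form the star `S` of r-2 edges; the edge from `i`
  -- to `j'` is kept as the partner `g` of the given edge. This fits because r-1 ≤ n-1.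
  obtain ⟨J', hJ', hJ'card⟩ := Finset.exists_subset_card_eq
    (s := Finset.univ.erase j) (n := r - 1) (by simp; omega)
  obtain ⟨j', hj'⟩ : J'.Nonempty := Finset.card_pos.1 (by omega)
  have hj : j ∉ J' := fun h => Finset.notMem_erase j _ (hJ' h)
  have hjJ : j ∉ J'.erase j' := fun h => hj (Finset.mem_of_mem_erase h)
  have hScard : (bipStar i (J'.erase j')).card + 2 = r := by
    rw [card_bipStar, Finset.card_erase_of_mem hj']
    omega
  have he : bipEdge i j ∉ bipStar i (J'.erase j') := by rwa [bipEdge_mem_bipStar]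
  have key : ∀ f, f ∉ bipStar i (J'.erase j') → f ≠ bipEdge i j →
      (graphicMatroid (completeBipartiteGraph (Fin m) (Fin n))).Indep
        (insert f (bipStar i (J'.erase j') : Set _)) →
      linkHessian ℝ (baseFinset (truncation (graphicMatroid
        (completeBipartiteGraph (Fin m) (Fin n))) r)) (bipStar i (J'.erase j'))
        (bipEdge i j) f ≠ 0 := by
    intro f hfS hfe hf
    refine linkHessian_ne_zero_iff.2 ⟨hfe.symm, he, hfS, subBasis_truncation_iff.2 ⟨?_, ?_⟩⟩
    · rw [Finset.coe_insert, Finset.coe_insert]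
      exact indep_insert_bipEdge hjJ hfe hf
    · rw [Finset.card_insert_of_notMem (by simp [hfe.symm, he]),
        Finset.card_insert_of_notMem hfS]
      omega
  refine (augmentable_baseFinset _).apply_eq_zero_of_linkHessian_mulVec hcard hv hScard
    (g := bipEdge i j') (key _ ?_ ?_ ?_) fun f hfS hfe hf => key f hfS hfe ?_
  · simp [bipEdge_mem_bipStar]
  · rw [Ne, bipEdge_inj]
    rintro ⟨-, rfl⟩
    exact hj hj'
  · refine (indep_bipStar i J').subset ?_
    rw [Set.insert_subset_iff]
    exact ⟨bipEdge_mem_bipStar.2 hj', Finset.coe_subset.2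
      (Finset.image_subset_image (Finset.erase_subset _ _))⟩
  · rw [← Finset.coe_insert]
    exact (subBasis_truncation_iff.1 hf).1

/-- The full star at one left vertex is independent and has `n` edges. -/
theorem le_eRank_completeBipartite (hm : 1 ≤ m) {r : ℕ} (hrn : r ≤ n) :
    (r : ℕ∞) ≤ (graphicMatroid (completeBipartiteGraph (Fin m) (Fin n))).eRank := by
  have h := (indep_bipStar (n := n) (⟨0, hm⟩ : Fin m) Finset.univ).encard_le_eRank
  rw [Set.encard_coe_eq_coe_finsetCard, card_bipStar, Finset.card_univ, Fintype.card_fin] at h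
  exact (Nat.cast_le.2 hrn).trans h

end CompleteBipartite

end TruncMatroid

theorem mainTheorem6 (K : Type*) [Field K] [CharZero K] (m n r : ℕ) (hm : 1 ≤ m)
    (hr : 2 < r) (hrn : r < n)
    (Φ : MvPolynomial (completeBipartiteGraph (Fin m) (Fin n)).edgeSet K)
    (hΦ : Φ = TruncMatroid.basisGenFun K (TruncMatroid.truncation
      (TruncMatroid.graphicMatroid (completeBipartiteGraph (Fin m) (Fin n))) r)) :
    Set.BijOn (fun a : MvPolynomial (completeBipartiteGraph (Fin m) (Fin n)).edgeSet K ⧸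
        TruncMatroid.annIdeal Φ => TruncMatroid.sumVars Φ ^ (r - 2) * a)
      (TruncMatroid.gradedPiece Φ 1) (TruncMatroid.gradedPiece Φ (r - 1)) := by
  classical
  have := Fintype.ofFinite (completeBipartiteGraph (Fin m) (Fin n)).edgeSet
  obtain ⟨k, rfl⟩ := Nat.exists_eq_add_of_le' hr.le
  have hcard : ∀ B ∈ TruncMatroid.baseFinset (TruncMatroid.truncation
      (TruncMatroid.graphicMatroid (completeBipartiteGraph (Fin m) (Fin n))) (k + 2)),
      B.card = k + 2 := fun B hB => TruncMatroid.card_of_mem_baseFinset_truncation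
    (TruncMatroid.le_eRank_completeBipartite hm hrn.le) hB
  rw [TruncMatroid.basisGenFun_eq] at hΦ
  exact TruncMatroid.bijOn_sumVars_pow_mul hcard (TruncMatroid.det_linkHessian_ne_zero fun v hv =>
    TruncMatroid.linkHessian_completeBipartite_injective hr.le hrn.le hcard v
      (by convert! hv)) hΦ
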